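/- Let $H$ be a finite abelian group, let $A$ be a $C^*$-algebra (not necessarily unital), and let $\beta\colon H\to\mathrm{Aut}(A)$ be an action by $*$-automorphisms. For a subgroup $L\le H$ write $A^L=\{a\in A:\beta_l(a)=a \text{ for all } l\in L\}$. Let $A\rtimes_\beta H$ be the crossed product, whose elements are the sums $\sum_{h\in H}a_hu_h$ with $a_h\in A$, where $u\colon H\to UM(A\rtimes_\beta H)$ is the canonical unitary representation implementing $\beta$. Let $\widehat H=\mathrm{Hom}(H,\mathbb T)$ be the dual group with pairing $\langle h,x\rangle=x(h)$, and let $\widehat\beta\colon\widehat H\to\mathrm{Aut}(A\rtimes_\beta H)$ be the dual action $\widehat\beta_x\big(\sum_h a_hu_h\big)=\sum_h\overline{\langle h,x\rangle}\,a_hu_h$. For a subgroup $L\le H$ let $L^\perp=\{x\in\widehat H:\langle l,x\rangle=1\text{ for all }l\in L\}$. View $A\rtimes_\beta H$ and $A\rtimes_\beta H\rtimes_{\widehat\beta}L^\perp$ as subalgebras of $A\rtimes_\beta H\rtimes_{\widehat\beta}\widehat H$ in the canonical way, and put $$p=\frac1{|H|}\sum_{h\in H}u_h,$$ a projection in $M(A\rtimes_\beta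 H)\subseteq M(A\rtimes_\beta H\rtimes_{\widehat\beta}\widehat H)$. Then there is a $*$-isomorphism $\psi\colon A\to p(A\rtimes_\beta H\rtimes_{\widehat\beta}\widehat H)p$ such that $$\psi(A^H)=p(A\rtimes_\beta H)p,$$ so that $\psi$ implements an isomorphism between the inclusions $A^H\subseteq A$ and $p(A\rtimes_\beta H)p\subseteq p(A\rtimes_\beta H\rtimes_{\widehat\beta}\widehat H)p$, and such that moreover, for every subgroup $L\le H$, $$\psi(A^L)=p(A\rtimes_\beta H\rtimes_{\widehat\beta}L^\perp)p .$$ -/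

import Mathlib

open scoped MultiplierAlgebra

noncomputable section

/-! ### Fixed points and corners -/

section Basic

variable {G A : Type*} [Group G] [NonUnitalCStarAlgebra A]

/-- The fixed-point algebra `A^G = {a ∈ A | α_g(a) = a for all g ∈ G}` of an action
`α : G → Aut(A)`. -/
def fixedPointAlgebra (α : G →* (A ≃⋆ₐ[ℂ] A)) : NonUnitalStarSubalgebra ℂ A where
  carrier := {a | ∀ g, α g a = a}
  add_mem' ha hb g := by rw [map_add, ha g, hb g]
  zero_mem' g := map_zero (α g)
  mul_mem' ha hb g := by rw [map_mul, ha g, hb g]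
  smul_mem' c a ha g := by rw [map_smul, ha g]
  star_mem' ha g := by rw [map_star, ha g]

theorem eq_of_forall_mul_right_eq {x y : A} (h : ∀ z, x * z = y * z) : x = y := by
  have h1 : (x - y) * star (x - y) = 0 := by rw [sub_mul, h, sub_self]
  exact sub_eq_zero.mp (CStarRing.mul_star_self_eq_zero_iff _ |>.mp h1)

theorem eq_of_forall_mul_left_eq {x y : A} (h : ∀ z, z * x = z * y) : x = y := by
  have h1 : star (x - y) * (x - y) = 0 := by rw [mul_sub, h, sub_self]
  exact sub_eq_zero.mp (CStarRing.star_mul_self_eq_zero_iff _ |>.mp h1)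

theorem multiplier_snd_mul (m : 𝓜(ℂ, A)) (x y : A) : m.snd (x * y) = x * m.snd y :=
  eq_of_forall_mul_right_eq fun z => by rw [m.central, mul_assoc, mul_assoc, m.central]

theorem multiplier_fst_mul (m : 𝓜(ℂ, A)) (x y : A) : m.fst (x * y) = m.fst x * y :=
  eq_of_forall_mul_left_eq fun z => by rw [← m.central, ← mul_assoc, m.central, mul_assoc]

/-- `A` is a right ideal of its multiplier algebra: `a * m` is the element `m.snd a` of `A`. -/
theorem coe_multiplier_snd (m : 𝓜(ℂ, A)) (a : A) :
    ((m.snd a : A) : 𝓜(ℂ, A)) = (a : 𝓜(ℂ, A)) * m := by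
  refine DoubleCentralizer.ext _ _ _ _ (Prod.ext ?_ ?_) <;> ext z
  · exact m.central a z
  · exact (multiplier_snd_mul m z a).symm

/-- `A` is a left ideal of its multiplier algebra: `m * a` is the element `m.fst a` of `A`. -/
theorem coe_multiplier_fst (m : 𝓜(ℂ, A)) (a : A) :
    ((m.fst a : A) : 𝓜(ℂ, A)) = m * (a : 𝓜(ℂ, A)) := by
  refine DoubleCentralizer.ext _ _ _ _ (Prod.ext ?_ ?_) <;> ext z
  · exact (multiplier_fst_mul m a z).symm
  · exact (m.central z a).symm

/-- For a projection `p ∈ M(A)`, the corner `pAp`, consisting of those elements of `A` that are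
of the form `p b p` with `b ∈ A` (the product being taken in `M(A)`). -/
def corner (p : 𝓜(ℂ, A)) (hp : IsStarProjection p) : NonUnitalStarSubalgebra ℂ A where
  carrier := {x | ∃ b : A, (x : 𝓜(ℂ, A)) = p * (b : 𝓜(ℂ, A)) * p}
  add_mem' := by
    rintro x y ⟨b, hb⟩ ⟨c, hc⟩
    refine ⟨b + c, ?_⟩
    have h1 := map_add (DoubleCentralizer.coeHom (𝕜 := ℂ) (A := A))
    simp only [DoubleCentralizer.coeHom_apply] at h1
    rw [h1, h1, hb, hc, mul_add, add_mul]
  zero_mem' := ⟨0, by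
    have h1 := map_zero (DoubleCentralizer.coeHom (𝕜 := ℂ) (A := A))
    simp only [DoubleCentralizer.coeHom_apply] at h1
    rw [h1, mul_zero, zero_mul]⟩
  mul_mem' := by
    rintro x y ⟨b, hb⟩ ⟨c, hc⟩
    refine ⟨p.snd b * c, ?_⟩
    have h1 := map_mul (DoubleCentralizer.coeHom (𝕜 := ℂ) (A := A))
    simp only [DoubleCentralizer.coeHom_apply] at h1
    have hpp : p * p = p := hp.isIdempotentElem
    rw [h1, h1, hb, hc, coe_multiplier_snd]
    calc p * (b : 𝓜(ℂ, A)) * p * (p * (c : 𝓜(ℂ, A)) * p)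
        = p * (b : 𝓜(ℂ, A)) * (p * p) * (c : 𝓜(ℂ, A)) * p := by simp only [mul_assoc]
      _ = p * ((b : 𝓜(ℂ, A)) * p * (c : 𝓜(ℂ, A))) * p := by rw [hpp]; simp only [mul_assoc]
  smul_mem' := by
    rintro r x ⟨b, hb⟩
    refine ⟨r • b, ?_⟩
    have h1 := map_smul (DoubleCentralizer.coeHom (𝕜 := ℂ) (A := A))
    simp only [DoubleCentralizer.coeHom_apply] at h1
    rw [h1, h1, hb, mul_smul_comm, smul_mul_assoc]
  star_mem' := by
    rintro x ⟨b, hb⟩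
    refine ⟨star b, ?_⟩
    have h1 := map_star (DoubleCentralizer.coeHom (𝕜 := ℂ) (A := A))
    simp only [DoubleCentralizer.coeHom_apply] at h1
    have hps : star p = p := hp.isSelfAdjoint
    rw [h1, h1, hb, star_mul, star_mul, hps, mul_assoc]

end Basic

theorem continuous_matrix_entry {n B : Type*} [NonUnitalCStarAlgebra B] (s t : n) : Continuous fun M : CStarMatrix n n B => M s t :=
  (continuous_apply t).comp (continuous_apply s)

/-! ### The crossed product by a finite group -/

/-- The crossed product `A ⋊_α G` of a C*-algebra by an action of a finite group.
Its elements are the formal sums `∑_g a_g u_g`, with arbitrary coefficients `a_g = coeff g ∈ A`. -/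
@[ext]
structure CrossedProduct {G A : Type*} [Group G] [NonUnitalCStarAlgebra A]
    (α : G →* (A ≃⋆ₐ[ℂ] A)) where
  coeff : G → A

namespace CrossedProduct

section Coefficients

variable {G A : Type*} [Group G] [NonUnitalCStarAlgebra A] (α : G →* (A ≃⋆ₐ[ℂ] A))

/-- An element of the crossed product is its family of coefficients. -/
def equivFun : CrossedProduct α ≃ (G → A) where
  toFun f := f.coeff
  invFun a := ⟨a⟩

instance : AddCommGroup (CrossedProduct α) := (equivFun α).addCommGroup

instance : Module ℂ (CrossedProduct α) := (equivFun α).module ℂ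

/-- The product determined by `(a u_g) (b u_h) = a α_g(b) u_{gh}`. -/
instance [Finite G] : Mul (CrossedProduct α) where
  mul f₁ f₂ := ⟨fun h =>
    letI := Fintype.ofFinite G
    ∑ k, f₁.coeff k * α k (f₂.coeff (k⁻¹ * h))⟩

/-- The involution determined by `(a u_g)^* = α_{g⁻¹}(a^*) u_{g⁻¹}`. -/
instance : Star (CrossedProduct α) where
  star f := ⟨fun h => α h (star (f.coeff h⁻¹))⟩

variable {α}

theorem coeff_zero (g : G) : (0 : CrossedProduct α).coeff g = 0 := rfl

theorem coeff_add (f₁ f₂ : CrossedProduct α) (g : G) :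
    (f₁ + f₂).coeff g = f₁.coeff g + f₂.coeff g := rfl

theorem coeff_smul (c : ℂ) (f : CrossedProduct α) (g : G) : (c • f).coeff g = c • f.coeff g := rfl

theorem coeff_star (f : CrossedProduct α) (g : G) :
    (star f).coeff g = α g (star (f.coeff g⁻¹)) := rfl

theorem coeff_mul [inst : Fintype G] (f₁ f₂ : CrossedProduct α) (h : G) :
    (f₁ * f₂).coeff h = ∑ k, f₁.coeff k * α k (f₂.coeff (k⁻¹ * h)) := by
  rw [Subsingleton.elim inst (Fintype.ofFinite G)]; rfl

theorem act_mul_apply (g h : G) (a : A) : α (g * h) a = α g (α h a) := by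
  rw [map_mul]; rfl

theorem act_one_apply (a : A) : α 1 a = a := by
  rw [map_one]; rfl

theorem act_inv_act (g : G) (a : A) : α g⁻¹ (α g a) = a := by
  rw [← act_mul_apply, inv_mul_cancel, act_one_apply]

theorem act_act_inv (g : G) (a : A) : α g (α g⁻¹ a) = a := by
  rw [← act_mul_apply, mul_inv_cancel, act_one_apply]

theorem continuous_act (g : G) : Continuous (α g) :=
  (NonUnitalStarAlgHom.isometry (α g) (α g).injective).continuous

/-- The regular representation, `a u_g ↦ (α_{s⁻¹}(a) δ_{s, g t})_{s, t}`. -/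
def regularRep (α : G →* (A ≃⋆ₐ[ℂ] A)) (f : CrossedProduct α) : CStarMatrix G G A :=
  CStarMatrix.ofMatrix (Matrix.of fun s t => α s⁻¹ (f.coeff (s * t⁻¹)))

theorem regularRep_apply (f : CrossedProduct α) (s t : G) :
    regularRep α f s t = α s⁻¹ (f.coeff (s * t⁻¹)) := rfl

theorem regularRep_injective : Function.Injective (regularRep α) := fun f₁ f₂ h => by
  ext g
  have h1 : regularRep α f₁ g 1 = regularRep α f₂ g 1 := by rw [h]
  rw [regularRep_apply, regularRep_apply] at h1
  simpa only [inv_one, mul_one] using (α g⁻¹).injective h1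

theorem regularRep_zero : regularRep α 0 = 0 := by
  refine CStarMatrix.ext fun s t => ?_
  exact map_zero (α s⁻¹)

theorem regularRep_add (f₁ f₂ : CrossedProduct α) :
    regularRep α (f₁ + f₂) = regularRep α f₁ + regularRep α f₂ := by
  refine CStarMatrix.ext fun s t => ?_
  exact map_add (α s⁻¹) _ _

theorem regularRep_smul (c : ℂ) (f : CrossedProduct α) :
    regularRep α (c • f) = c • regularRep α f := by
  refine CStarMatrix.ext fun s t => ?_
  exact map_smul (α s⁻¹) _ _

theorem regularRep_star (f : CrossedProduct α) :
    regularRep α (star f) = star (regularRep α f) := by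
  refine CStarMatrix.ext fun s t => ?_
  rw [CStarMatrix.star_apply, regularRep_apply, regularRep_apply, coeff_star, ← map_star,
    ← act_mul_apply]
  simp

theorem regularRep_mul [Fintype G] (f₁ f₂ : CrossedProduct α) :
    regularRep α (f₁ * f₂) = regularRep α f₁ * regularRep α f₂ := by
  refine CStarMatrix.ext fun s t => ?_
  rw [regularRep_apply, coeff_mul, CStarMatrix.mul_apply, map_sum]
  refine Fintype.sum_equiv ((Equiv.inv G).trans (Equiv.mulRight s)) _ _ fun k => ?_
  simp only [Equiv.trans_apply, Equiv.inv_apply, Equiv.coe_mulRight, regularRep_apply]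
  rw [map_mul (α s⁻¹), ← act_mul_apply]
  simp only [mul_inv_rev, inv_inv, mul_assoc, mul_inv_cancel_left]

end Coefficients

/-! ### The C*-norm

The crossed product acts faithfully by adjointable operators on the Hilbert `A`-module `ℓ²(G, A)`
through the regular representation, that is, it is a *-algebra of `G × G` matrices over `A`;
its norm is the operator norm in this representation.  As `G` is finite, the crossed product is
complete for this norm, which is therefore its only C*-norm (so that there is no difference between
the full and the reduced crossed product). -/

section Norm

variable {G A : Type*} [Group G] [Finite G] [NonUnitalCStarAlgebra A] {α : G →* (A ≃⋆ₐ[ℂ] A)}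

instance : NonUnitalRing (CrossedProduct α) :=
  letI := Fintype.ofFinite G
  Function.Injective.nonUnitalRing (regularRep α) regularRep_injective regularRep_zero
    regularRep_add regularRep_mul
    (fun _ => CStarMatrix.ext fun s _ => map_neg (α s⁻¹) _)
    (fun _ _ => CStarMatrix.ext fun s _ => map_sub (α s⁻¹) _ _)
    (fun n _ => CStarMatrix.ext fun s _ => map_nsmul (α s⁻¹) n _)
    (fun n _ => CStarMatrix.ext fun s _ => map_zsmul (α s⁻¹) n _)

instance : StarRing (CrossedProduct α) where
  star_involutive f := by
    ext g
    rw [coeff_star, coeff_star, ← map_star, act_act_inv, star_star, inv_inv]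
  star_mul f₁ f₂ := by
    let := Fintype.ofFinite G
    refine regularRep_injective ?_
    rw [regularRep_star, regularRep_mul, regularRep_mul, regularRep_star, regularRep_star, star_mul]
  star_add f₁ f₂ := by
    ext g
    simp only [coeff_star, coeff_add, star_add, map_add]

instance : StarModule ℂ (CrossedProduct α) where
  star_smul c f := by
    ext g
    simp only [coeff_star, coeff_smul, star_smul, map_smul]

instance : IsScalarTower ℂ (CrossedProduct α) (CrossedProduct α) where
  smul_assoc c f₁ f₂ := by
    let := Fintype.ofFinite G
    ext g
    simp only [smul_eq_mul, coeff_mul, coeff_smul, Finset.smul_sum, smul_mul_assoc]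

instance : SMulCommClass ℂ (CrossedProduct α) (CrossedProduct α) where
  smul_comm c f₁ f₂ := by
    let := Fintype.ofFinite G
    ext g
    simp only [smul_eq_mul, coeff_mul, coeff_smul, Finset.smul_sum, mul_smul_comm, map_smul]

instance : NonUnitalNormedRing (CrossedProduct α) :=
  letI := Fintype.ofFinite G
  letI := CStarAlgebra.spectralOrder A
  letI := CStarAlgebra.spectralOrderedRing A
  NonUnitalNormedRing.induced (CrossedProduct α) (CStarMatrix G G A)
    ({ toFun := regularRep α
       map_mul' := regularRep_mul
       map_zero' := regularRep_zero
       map_add' := regularRep_add } : CrossedProduct α →ₙ+* CStarMatrix G G A)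
    regularRep_injective

/-- The norm of the crossed product is the one of the regular representation. -/
theorem norm_eq [inst : Fintype G] (f : CrossedProduct α) :
    let := CStarAlgebra.spectralOrder A
    let := CStarAlgebra.spectralOrderedRing A
    ‖f‖ = ‖regularRep α f‖ := by
  rw [Subsingleton.elim inst (Fintype.ofFinite G)]; rfl

theorem isUniformInducing_regularRep : IsUniformInducing (regularRep α) := by
  let := Fintype.ofFinite G
  let := CStarAlgebra.spectralOrder A
  let := CStarAlgebra.spectralOrderedRing A
  have h : Isometry (regularRep α) := by
    refine Isometry.of_dist_eq fun f₁ f₂ => ?_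
    rw [dist_eq_norm, dist_eq_norm, norm_eq]
    congr 1
    exact CStarMatrix.ext fun s _ => (map_sub (α s⁻¹) _ _).symm
  exact h.isUniformInducing

theorem continuous_coeff (g : G) : Continuous fun f : CrossedProduct α => f.coeff g := by
  have h : Continuous fun f : CrossedProduct α => α g (regularRep α f g 1) :=
    (continuous_act g).comp <| (continuous_matrix_entry g 1).comp
      isUniformInducing_regularRep.isInducing.continuous
  refine h.congr fun f => ?_
  rw [regularRep_apply, act_act_inv, inv_one, mul_one]

theorem continuous_of_coeff {X : Type*} [TopologicalSpace X] {F : X → CrossedProduct α}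
    (h : ∀ g, Continuous fun x => (F x).coeff g) : Continuous F :=
  isUniformInducing_regularRep.isInducing.continuous_iff.mpr <|
    continuous_pi fun s => continuous_pi fun t => (continuous_act s⁻¹).comp (h (s * t⁻¹))

instance : CompleteSpace (CrossedProduct α) := by
  let := Fintype.ofFinite G
  have hr : IsClosed (Set.range (regularRep α)) := by
    have : Set.range (regularRep α) =
        ⋂ s : G, ⋂ t : G, {M : CStarMatrix G G A | M s t = α s⁻¹ (M 1 (t * s⁻¹))} := by
      ext M
      simp only [Set.mem_range, Set.mem_iInter, Set.mem_ofPred_eq]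
      constructor
      · rintro ⟨f, rfl⟩ s t
        rw [regularRep_apply, regularRep_apply, inv_one, act_one_apply]
        simp
      · intro h
        refine ⟨⟨fun g => M 1 g⁻¹⟩, CStarMatrix.ext fun s t => ?_⟩
        rw [h s t, regularRep_apply]
        simp
    rw [this]
    exact isClosed_iInter fun s => isClosed_iInter fun t =>
      isClosed_eq (continuous_matrix_entry s t) ((continuous_act s⁻¹).comp (continuous_matrix_entry 1 _))
  exact isUniformInducing_regularRep.completeSpace hr.isComplete

instance : CStarRing (CrossedProduct α) where
  norm_mul_self_le f := by
    let := Fintype.ofFinite G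
    let := CStarAlgebra.spectralOrder A
    let := CStarAlgebra.spectralOrderedRing A
    rw [norm_eq, norm_eq, regularRep_mul, regularRep_star, CStarRing.norm_star_mul_self]

instance : NormedSpace ℂ (CrossedProduct α) where
  norm_smul_le c f := by
    let := Fintype.ofFinite G
    let := CStarAlgebra.spectralOrder A
    let := CStarAlgebra.spectralOrderedRing A
    rw [norm_eq, norm_eq, regularRep_smul]
    exact norm_smul_le _ _

instance : NonUnitalCStarAlgebra (CrossedProduct α) where

end Norm

/-! ### Canonical maps -/

section Maps

variable {G A : Type*} [Group G] [Finite G] [NonUnitalCStarAlgebra A] (α : G →* (A ≃⋆ₐ[ℂ] A))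

open Classical in
/-- For a subgroup `K ≤ G`, the canonical inclusion `A ⋊_α K ⊆ A ⋊_α G`, which sends
`∑_{k ∈ K} a_k u_k` to `∑_{k ∈ K} a_k u_k`. -/
def subgroupInclusion (K : Subgroup G) :
    CrossedProduct (α.comp K.subtype) →⋆ₙₐ[ℂ] CrossedProduct α where
  toFun f := ⟨fun g => if h : g ∈ K then f.coeff ⟨g, h⟩ else 0⟩
  map_zero' := by ext g; simp [coeff_zero]
  map_add' f₁ f₂ := by
    ext g
    by_cases h : g ∈ K <;> simp [coeff_add, h]
  map_smul' c f := by
    ext g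
    by_cases h : g ∈ K <;> simp [coeff_smul, h]
  map_star' f := by
    ext g
    by_cases h : g ∈ K
    · have h' : g⁻¹ ∈ K := K.inv_mem h
      simp only [coeff_star, h, h', dite_true]
      rfl
    · have h' : g⁻¹ ∉ K := fun h'' => h (by simpa using K.inv_mem h'')
      simp [coeff_star, h]
  map_mul' f₁ f₂ := by
    let := Fintype.ofFinite G
    ext g
    rw [coeff_mul]
    have h0 : ∀ k : G, k ∉ Set.range (Subtype.val : K → G) →
        (if h : k ∈ K then f₁.coeff ⟨k, h⟩ else 0) *
          α k (if h : k⁻¹ * g ∈ K then f₂.coeff ⟨k⁻¹ * g, h⟩ else 0) = 0 := by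
      intro k hk
      have hk' : k ∉ K := fun h => hk ⟨⟨k, h⟩, rfl⟩
      simp [hk']
    rw [← Fintype.sum_of_injective (Subtype.val : K → G) Subtype.val_injective
      (fun k => f₁.coeff k * α k (if h : (k : G)⁻¹ * g ∈ K then f₂.coeff ⟨(k : G)⁻¹ * g, h⟩ else 0))
      _ h0 (fun k => by simp)]
    by_cases h : g ∈ K
    · simp only [h, dite_true, coeff_mul]
      refine Finset.sum_congr rfl fun k _ => ?_
      have h' : (k : G)⁻¹ * g ∈ K := K.mul_mem (K.inv_mem k.2) h
      simp only [h', dite_true]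
      rfl
    · have h' : ∀ k : K, (k : G)⁻¹ * g ∉ K := fun k hk =>
        h (by simpa using K.mul_mem k.2 hk)
      simp [h, h']

open Classical in
/-- The canonical inclusion `A ⊆ A ⋊_α G`, `a ↦ a u_e`. -/
def inclusion : A →⋆ₙₐ[ℂ] CrossedProduct α where
  toFun a := ⟨fun g => if g = 1 then a else 0⟩
  map_zero' := by ext g; simp [coeff_zero]
  map_add' a b := by
    ext g
    by_cases h : g = 1 <;> simp [coeff_add, h]
  map_smul' c a := by
    ext g
    by_cases h : g = 1 <;> simp [coeff_smul, h]
  map_star' a := by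
    ext g
    by_cases h : g = 1
    · subst h
      simp [coeff_star]
    · simp [coeff_star, h]
  map_mul' a b := by
    let := Fintype.ofFinite G
    ext g
    rw [coeff_mul, Finset.sum_eq_single 1]
    · by_cases h : g = 1 <;> simp [h]
    · intro k _ hk
      simp [hk]
    · simp

/-- The multiplier `u_h` of `A ⋊_α G`, determined by `u_h (a u_k) = α_h(a) u_{hk}` and
`(a u_k) u_h = a u_{kh}`. -/
def groupMultiplier (h : G) : 𝓜(ℂ, CrossedProduct α) where
  fst :=
    { toFun f := ⟨fun k => α h (f.coeff (h⁻¹ * k))⟩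
      map_add' f₁ f₂ := by ext k; simp [coeff_add]
      map_smul' c f := by ext k; simp [coeff_smul]
      cont := continuous_of_coeff fun k => (continuous_act h).comp (continuous_coeff (h⁻¹ * k)) }
  snd :=
    { toFun f := ⟨fun k => f.coeff (k * h⁻¹)⟩
      map_add' f₁ f₂ := by ext k; simp [coeff_add]
      map_smul' c f := by ext k; simp [coeff_smul]
      cont := continuous_of_coeff fun k => continuous_coeff (k * h⁻¹) }
  central f₁ f₂ := by
    let := Fintype.ofFinite G
    ext g
    rw [coeff_mul, coeff_mul]
    refine Fintype.sum_equiv (Equiv.mulRight h⁻¹) _ _ fun k => ?_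
    simp only [ContinuousLinearMap.coe_mk', LinearMap.coe_mk, AddHom.coe_mk, Equiv.coe_mulRight,
      mul_inv_rev, inv_inv, ← act_mul_apply, mul_assoc, inv_mul_cancel_left, inv_mul_cancel, mul_one]

theorem multiplier_ext {B : Type*} [NonUnitalCStarAlgebra B] {m n : 𝓜(ℂ, B)}
    (h₁ : ∀ b, m.fst b = n.fst b) (h₂ : ∀ b, m.snd b = n.snd b) : m = n :=
  DoubleCentralizer.ext _ _ _ _
    (Prod.ext (ContinuousLinearMap.ext h₁) (ContinuousLinearMap.ext h₂))

theorem coeff_groupMultiplier_fst (h k : G) (f : CrossedProduct α) :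
    ((groupMultiplier α h).fst f).coeff k = α h (f.coeff (h⁻¹ * k)) := rfl

theorem coeff_groupMultiplier_snd (h k : G) (f : CrossedProduct α) :
    ((groupMultiplier α h).snd f).coeff k = f.coeff (k * h⁻¹) := rfl

theorem groupMultiplier_one : groupMultiplier α 1 = 1 := by
  refine multiplier_ext (fun f => ?_) (fun f => ?_)
  · ext k
    rw [coeff_groupMultiplier_fst, act_one_apply, inv_one, one_mul]
    rfl
  · ext k
    rw [coeff_groupMultiplier_snd, inv_one, mul_one]
    rfl

theorem groupMultiplier_mul (g h : G) :
    groupMultiplier α (g * h) = groupMultiplier α g * groupMultiplier α h := by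
  refine multiplier_ext (fun f => ?_) (fun f => ?_)
  · ext k
    change _ = ((groupMultiplier α g).fst ((groupMultiplier α h).fst f)).coeff k
    rw [coeff_groupMultiplier_fst, coeff_groupMultiplier_fst, coeff_groupMultiplier_fst,
      act_mul_apply, mul_inv_rev, mul_assoc]
  · ext k
    change _ = ((groupMultiplier α h).snd ((groupMultiplier α g).snd f)).coeff k
    rw [coeff_groupMultiplier_snd, coeff_groupMultiplier_snd, coeff_groupMultiplier_snd,
      mul_inv_rev, mul_assoc]

theorem star_groupMultiplier (h : G) :
    star (groupMultiplier α h) = groupMultiplier α h⁻¹ := by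
  refine multiplier_ext (fun f => ?_) (fun f => ?_)
  · ext k
    rw [DoubleCentralizer.star_fst, coeff_star, coeff_groupMultiplier_snd,
      coeff_groupMultiplier_fst, coeff_star, ← map_star, star_star, ← act_mul_apply]
    simp
  · ext k
    rw [DoubleCentralizer.star_snd, coeff_star, coeff_groupMultiplier_fst,
      coeff_groupMultiplier_snd, coeff_star, ← map_star, ← map_star, star_star, ← act_mul_apply,
      ← act_mul_apply]
    simp

/-- The canonical unitary representation `u : G → UM(A ⋊_α G)`. -/
def canonicalUnitary : G →* unitary 𝓜(ℂ, CrossedProduct α) where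
  toFun h := ⟨groupMultiplier α h, by
    rw [Unitary.mem_iff, star_groupMultiplier, ← groupMultiplier_mul, ← groupMultiplier_mul,
      inv_mul_cancel, mul_inv_cancel, groupMultiplier_one]
    exact ⟨rfl, rfl⟩⟩
  map_one' := Subtype.ext (groupMultiplier_one α)
  map_mul' g h := Subtype.ext (groupMultiplier_mul α g h)

/-- The canonical unitaries implement the action: `u_g a u_g^* = α_g(a)`. -/
theorem canonicalUnitary_conj (g : G) (a : A) :
    (canonicalUnitary α g : 𝓜(ℂ, CrossedProduct α)) * (inclusion α a : 𝓜(ℂ, CrossedProduct α)) *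
      star (canonicalUnitary α g : 𝓜(ℂ, CrossedProduct α)) = inclusion α (α g a) := by
  change groupMultiplier α g * _ * star (groupMultiplier α g) = _
  rw [star_groupMultiplier, ← coe_multiplier_fst, ← coe_multiplier_snd]
  congr 1
  ext k
  rw [coeff_groupMultiplier_snd, coeff_groupMultiplier_fst]
  by_cases h : k = 1
  · subst h
    simp [inclusion]
  · have h' : ¬ g⁻¹ * k * g = 1 := fun h'' => h (by
      rw [mul_assoc, inv_mul_eq_one] at h''
      exact right_eq_mul.mp h'')
    simp [inclusion, h, h', ← mul_assoc]

/-- The projection `p = |G|⁻¹ ∑_g u_g ∈ M(A ⋊_α G)`. -/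
def averagingProjection : 𝓜(ℂ, CrossedProduct α) :=
  letI := Fintype.ofFinite G
  (Nat.card G : ℂ)⁻¹ • ∑ g : G, (canonicalUnitary α g : 𝓜(ℂ, CrossedProduct α))

theorem isStarProjection_averagingProjection : IsStarProjection (averagingProjection α) := by
  let := Fintype.ofFinite G
  set S : 𝓜(ℂ, CrossedProduct α) := ∑ g : G, groupMultiplier α g with hS
  have hp : averagingProjection α = (Nat.card G : ℂ)⁻¹ • S := rfl
  have hstar : star S = S := by
    rw [hS, star_sum]
    simp only [star_groupMultiplier]
    exact Fintype.sum_equiv (Equiv.inv G) _ _ fun _ => rfl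
  have hmul : S * S = (Nat.card G : ℂ) • S := by
    have h1 : ∀ g, groupMultiplier α g * S = S := fun g => by
      rw [hS, Finset.mul_sum]
      simp only [← groupMultiplier_mul]
      exact Fintype.sum_equiv (Equiv.mulLeft g) _ _ fun _ => rfl
    conv_lhs => rw [hS, Finset.sum_mul]
    rw [← hS]
    simp only [h1, Finset.sum_const, Finset.card_univ, Nat.card_eq_fintype_card]
    exact (Nat.cast_smul_eq_nsmul ℂ _ S).symm
  have hc : (Nat.card G : ℂ) ≠ 0 := Nat.cast_ne_zero.mpr Nat.card_pos.ne'
  constructor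
  · change _ * _ = _
    rw [hp, smul_mul_smul_comm, hmul, smul_smul, inv_mul_cancel_right₀ hc]
  · change star _ = _
    rw [hp, star_smul, hstar, star_inv₀, star_natCast]

/-- The canonical unital inclusion `M(A) ⊆ M(A ⋊_α G)`, determined by `m (a u_g) = (m a) u_g` and
`(a u_g) m = a α_g(m) u_g`, where `a α_g(m) = α_g(α_{g⁻¹}(a) m)`. -/
def multiplierInclusion : 𝓜(ℂ, A) →⋆ₐ[ℂ] 𝓜(ℂ, CrossedProduct α) where
  toFun m :=
    { fst :=
        { toFun f := ⟨fun k => m.fst (f.coeff k)⟩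
          map_add' f₁ f₂ := by ext k; simp [coeff_add]
          map_smul' c f := by ext k; simp [coeff_smul]
          cont := continuous_of_coeff fun k => m.fst.continuous.comp (continuous_coeff k) }
      snd :=
        { toFun f := ⟨fun k => α k (m.snd (α k⁻¹ (f.coeff k)))⟩
          map_add' f₁ f₂ := by ext k; simp [coeff_add]
          map_smul' c f := by ext k; simp [coeff_smul]
          cont := continuous_of_coeff fun k => (continuous_act k).comp <|
            m.snd.continuous.comp <| (continuous_act k⁻¹).comp (continuous_coeff k) }
      central f₁ f₂ := by
        let := Fintype.ofFinite G
        ext g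
        rw [coeff_mul, coeff_mul]
        refine Finset.sum_congr rfl fun k _ => ?_
        simp only [ContinuousLinearMap.coe_mk', LinearMap.coe_mk, AddHom.coe_mk]
        rw [← map_mul, m.central, map_mul, act_act_inv] }
  map_one' := multiplier_ext (fun f => rfl) fun f => by
    ext k
    exact act_act_inv k _
  map_mul' m n := multiplier_ext (fun f => rfl) fun f => by
    ext k
    change α k (n.snd (m.snd _)) = α k (n.snd (α k⁻¹ (α k (m.snd _))))
    rw [act_inv_act]
  map_zero' := multiplier_ext (fun f => rfl) fun f => by
    ext k
    exact map_zero (α k)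
  map_add' m n := multiplier_ext (fun f => rfl) fun f => by
    ext k
    exact map_add (α k) _ _
  commutes' c := multiplier_ext (fun f => rfl) fun f => by
    ext k
    change α k (c • α k⁻¹ (f.coeff k)) = c • f.coeff k
    rw [map_smul, act_act_inv]
  map_star' m := by
    refine multiplier_ext (fun f => ?_) fun f => ?_
    · ext k
      change star (m.snd (star (f.coeff k))) =
        α k (star (α k⁻¹ (m.snd (α k⁻¹⁻¹ (α k⁻¹ (star (f.coeff k⁻¹⁻¹)))))))
      rw [← map_star (α k⁻¹), act_act_inv, act_inv_act, inv_inv]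
    · ext k
      change α k (star (m.fst (star (α k⁻¹ (f.coeff k))))) =
        α k (star (m.fst (α k⁻¹ (star (f.coeff k⁻¹⁻¹)))))
      rw [inv_inv, map_star (α k⁻¹)]

/-- The inclusion `M(A) ⊆ M(A ⋊_α G)` extends the inclusion `A ⊆ A ⋊_α G`. -/
theorem multiplierInclusion_coe (a : A) :
    multiplierInclusion α (a : 𝓜(ℂ, A)) = (inclusion α a : 𝓜(ℂ, CrossedProduct α)) := by
  let := Fintype.ofFinite G
  refine multiplier_ext (fun f => ?_) fun f => ?_
  · ext k
    change a * f.coeff k = (inclusion α a * f).coeff k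
    rw [coeff_mul, Finset.sum_eq_single 1]
    · simp [inclusion]
    · intro b _ hb
      simp [inclusion, hb]
    · simp
  · ext k
    change α k (α k⁻¹ (f.coeff k) * a) = (f * inclusion α a).coeff k
    rw [coeff_mul, Finset.sum_eq_single k]
    · rw [map_mul, act_act_inv]
      simp [inclusion]
    · intro b _ hb
      have : ¬ b⁻¹ * k = 1 := fun h => hb (inv_mul_eq_one.mp h)
      simp [inclusion, this]
    · simp

end Maps

/-! ### The dual action -/

section Dual

variable {H A : Type*} [CommGroup H] [Finite H] [NonUnitalCStarAlgebra A]

/-- The dual group `Ĥ = Hom(H, 𝕋)` of a finite abelian group (with pairing `⟨h, x⟩ = x h`)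
is finite. -/
instance finite_dual : Finite (H →* Circle) := by
  refine Finite.of_injective (fun x : H →* Circle => Circle.toUnits.comp x) fun x y h => ?_
  ext g
  have h1 := congrArg Units.val (DFunLike.congr_fun h g)
  exact h1

/-- The annihilator `L^⊥ = {x ∈ Ĥ | ⟨l, x⟩ = 1 for all l ∈ L}` of a subgroup `L ≤ H`. -/
def annihilator (L : Subgroup H) : Subgroup (H →* Circle) where
  carrier := {x | ∀ l ∈ L, x l = 1}
  mul_mem' hx hy l hl := by rw [MonoidHom.mul_apply, hx l hl, hy l hl, one_mul]
  one_mem' _ _ := rfl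
  inv_mem' hx l hl := by rw [MonoidHom.inv_apply, hx l hl, inv_one]

/-- The automorphism `β̂_x` of `A ⋊_β H`, `∑ a_h u_h ↦ ∑ conj ⟨h, x⟩ a_h u_h`. -/
def dualAut (β : H →* (A ≃⋆ₐ[ℂ] A)) (x : H →* Circle) :
    CrossedProduct β ≃⋆ₐ[ℂ] CrossedProduct β where
  toFun f := ⟨fun h => star (x h : ℂ) • f.coeff h⟩
  invFun f := ⟨fun h => (x h : ℂ) • f.coeff h⟩
  left_inv f := by
    ext h
    simp [smul_smul, Complex.mul_conj]
  right_inv f := by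
    ext h
    simp [smul_smul, Complex.mul_conj, mul_comm]
  map_mul' f₁ f₂ := by
    let := Fintype.ofFinite H
    ext h
    simp only [coeff_mul, Finset.smul_sum]
    refine Finset.sum_congr rfl fun k _ => ?_
    rw [map_smul, smul_mul_smul_comm, ← star_mul', ← Circle.coe_mul, ← map_mul,
      mul_inv_cancel_left]
  map_add' f₁ f₂ := by
    ext h
    simp [coeff_add]
  map_star' f := by
    ext h
    simp only [coeff_star, star_smul, star_star, map_smul, map_inv, Circle.coe_inv_eq_conj]
    rfl
  map_smul' c f := by
    ext h
    simp only [coeff_smul]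
    rw [smul_comm]

/-- The dual action `β̂ : Ĥ → Aut(A ⋊_β H)`. -/
def dualAction (β : H →* (A ≃⋆ₐ[ℂ] A)) :
    (H →* Circle) →* (CrossedProduct β ≃⋆ₐ[ℂ] CrossedProduct β) where
  toFun := dualAut β
  map_one' := by
    ext f h
    change star (((1 : H →* Circle) h : Circle) : ℂ) • f.coeff h = f.coeff h
    simp
  map_mul' x y := by
    ext f h
    change star (((x * y) h : Circle) : ℂ) • f.coeff h =
      star (x h : ℂ) • star (y h : ℂ) • f.coeff h
    rw [MonoidHom.mul_apply, Circle.coe_mul, star_mul', smul_smul]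

end Dual

end CrossedProduct

end

/-! Write an element of the double crossed product as `F = ∑ F_x v_x`, with `v_x` the unitaries of
the dual group and `F_x = ∑ F_{x,h} u_h`, and put `a_x = F_{x,1}`. The condition `p F = F` says
`F_{x,h} = β_h(a_x)`. Moving `p` past `v_x` turns `F p = F` into `F_{x,h} = conj x(h) a_x`. So `F`
lies in the corner exactly when it is determined in this way by a family `(a_x)` with `β_h(a_x) =
conj x(h) a_x`, that is, with `a_x` in the spectral subspace of `A` of degree `x`; then `F = |H| ∑
a_x v_x p`.

The evaluation `F ↦ |H| ∑ a_x` (`dualCornerEval`) is a `*`-homomorphism to `A`. It is bijective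
because `A` is the direct sum of its spectral subspaces: orthogonality of characters recovers the
components (`coeff_one_eq_sum_act_dualCornerEval`) and produces them for any `a`
(`dualCornerEval_surjective`). The isomorphism `ψ` is its inverse.

An element `l` acts on degree `x` by `conj x(l)`, so `A^L` consists of the elements whose components
are supported on `L^⊥` (`dualCornerEval_fixed_iff`). The same support condition cuts out `p(A ⋊ H ⋊
L^⊥)p`. The algebra `A^H` corresponds to support at the trivial character. -/

/-! ### Corners described by one-sided multiplication -/

theorem mem_corner_iff {B : Type*} [NonUnitalCStarAlgebra B] {p : 𝓜(ℂ, B)} {hp : IsStarProjection p}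
    {b : B} : b ∈ corner p hp ↔ p.fst b = b ∧ p.snd b = b := by
  have hpp : p * p = p := hp.isIdempotentElem
  -- Left multiplication by an element determines it, so identities in `𝓜(ℂ, B)` can be brought back
  -- to `B`.
  have hinj : Function.Injective ((↑) : B → 𝓜(ℂ, B)) := fun x y h =>
    eq_of_forall_mul_right_eq fun z => congrArg (fun m : 𝓜(ℂ, B) => m.fst z) h
  constructor
  · rintro ⟨c, hc⟩
    refine ⟨hinj ?_, hinj ?_⟩
    · rw [coe_multiplier_fst, hc, ← mul_assoc, ← mul_assoc, hpp]
    · rw [coe_multiplier_snd, hc, mul_assoc, hpp]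
  · rintro ⟨h₁, h₂⟩
    refine ⟨b, ?_⟩
    rw [← coe_multiplier_fst, h₁, ← coe_multiplier_snd, h₂]

theorem star_circle_mul_self (z : Circle) : star (z : ℂ) * (z : ℂ) = 1 := by
  rw [← starRingEnd_apply, Complex.conj_mul', Circle.norm_coe, Complex.ofReal_one, one_pow]

theorem circle_mul_star_self (z : Circle) : (z : ℂ) * star (z : ℂ) = 1 := by
  rw [mul_comm, star_circle_mul_self]

/-! ### Circle-valued characters and their orthogonality -/

section Characters

variable {H : Type*} [CommGroup H]

/-- Characters into `ℂˣ` separate points, and on a finite group their values are roots of unity,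
hence lie on the circle. -/
theorem exists_circle_character_ne_one [Finite H] {h : H} (hh : h ≠ 1) :
    ∃ x : H →* Circle, x h ≠ 1 := by
  obtain ⟨χ, hχ⟩ := CommGroup.exists_apply_ne_one_of_hasEnoughRootsOfUnity H ℂ hh
  have hnorm (g : H) : ‖(χ g : ℂ)‖ = 1 := by
    refine Complex.norm_eq_one_of_pow_eq_one (n := Nat.card H) ?_ Nat.card_pos.ne'
    rw [← Units.val_pow_eq_pow_val, ← map_pow, pow_card_eq_one', map_one, Units.val_one]
  refine ⟨⟨⟨fun g => ⟨χ g, mem_sphere_zero_iff_norm.2 (hnorm g)⟩, ?_⟩, ?_⟩, fun hx => hχ ?_⟩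
  · ext; simp
  · intro a b
    refine Circle.ext ?_
    change ((χ (a * b) : ℂˣ) : ℂ) = (χ a : ℂ) * (χ b : ℂ)
    rw [map_mul, Units.val_mul]
  · exact Units.ext (congrArg ((↑) : Circle → ℂ) hx)

theorem sum_circle_character [Fintype H] {x : H →* Circle} (hx : x ≠ 1) :
    ∑ h, (x h : ℂ) = 0 := by
  refine sum_hom_units_eq_zero (Circle.coeHom.comp x) fun h => hx ?_
  ext g
  exact DFunLike.congr_fun h g

theorem sum_circle_mul_star [Fintype H] {x y : H →* Circle} (hxy : x ≠ y) :
    ∑ h, (x h : ℂ) * star (y h : ℂ) = 0 := by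
  rw [← sum_circle_character (mul_inv_eq_one.not.2 hxy)]
  refine Finset.sum_congr rfl fun h _ => ?_
  rw [MonoidHom.mul_apply, MonoidHom.inv_apply, Circle.coe_mul, Circle.coe_inv_eq_conj]
  rfl

/-- Evaluation at `h` is a character of the dual group, and it is nontrivial because characters
separate points. -/
theorem sum_circle_dual [Finite H] [Fintype (H →* Circle)] {h : H} (hh : h ≠ 1) :
    ∑ x : H →* Circle, (x h : ℂ) = 0 := by
  refine sum_hom_units_eq_zero (Circle.coeHom.comp (MonoidHom.eval h)) fun H' => ?_
  obtain ⟨x, hx⟩ := exists_circle_character_ne_one hh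
  exact hx (Circle.ext (DFunLike.congr_fun H' x))

end Characters

/-- Double counting of `∑ x(h)` over all pairs: by orthogonality only `x = 1` contributes in one
order of summation, and only `h = 1` in the other. -/
theorem card_circle_dual (H : Type*) [CommGroup H] [Finite H] :
    Nat.card (H →* Circle) = Nat.card H := by
  classical
  let := Fintype.ofFinite H
  let := Fintype.ofFinite (H →* Circle)
  have h₁ : ∑ x : H →* Circle, ∑ h : H, (x h : ℂ) = Nat.card H := by
    rw [Finset.sum_eq_single 1 (fun x _ hx => sum_circle_character hx) (by simp)]
    simp
  have h₂ : ∑ h : H, ∑ x : H →* Circle, (x h : ℂ) = Nat.card (H →* Circle) := by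
    rw [Finset.sum_eq_single 1 (fun h _ hh => sum_circle_dual hh) (by simp)]
    simp
  rw [Finset.sum_comm, h₁] at h₂
  exact_mod_cast h₂.symm

namespace CrossedProduct

/-! ### The averaging projection acting on a crossed product -/

section Averaging

variable {G A : Type*} [Group G] [Finite G] [NonUnitalCStarAlgebra A] (α : G →* (A ≃⋆ₐ[ℂ] A))

theorem averagingProjection_fst [inst : Fintype G] (f : CrossedProduct α) :
    (averagingProjection α).fst f =
      (Nat.card G : ℂ)⁻¹ • ∑ g : G, (groupMultiplier α g).fst f := by
  obtain rfl := Subsingleton.elim inst (Fintype.ofFinite G)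
  let := Fintype.ofFinite G
  let φ : 𝓜(ℂ, CrossedProduct α) →ₗ[ℂ] CrossedProduct α :=
    { toFun m := m.fst f, map_add' _ _ := rfl, map_smul' _ _ := rfl }
  change φ ((Nat.card G : ℂ)⁻¹ • ∑ g : G, groupMultiplier α g) = _
  rw [map_smul, map_sum]
  rfl

theorem averagingProjection_snd [inst : Fintype G] (f : CrossedProduct α) :
    (averagingProjection α).snd f =
      (Nat.card G : ℂ)⁻¹ • ∑ g : G, (groupMultiplier α g).snd f := by
  obtain rfl := Subsingleton.elim inst (Fintype.ofFinite G)
  let := Fintype.ofFinite G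
  let φ : 𝓜(ℂ, CrossedProduct α) →ₗ[ℂ] CrossedProduct α :=
    { toFun m := m.snd f, map_add' _ _ := rfl, map_smul' _ _ := rfl }
  change φ ((Nat.card G : ℂ)⁻¹ • ∑ g : G, groupMultiplier α g) = _
  rw [map_smul, map_sum]
  rfl

theorem groupMultiplier_mul_averagingProjection (g : G) :
    groupMultiplier α g * averagingProjection α = averagingProjection α := by
  let := Fintype.ofFinite G
  change groupMultiplier α g * ((Nat.card G : ℂ)⁻¹ • ∑ k : G, groupMultiplier α k) =
    (Nat.card G : ℂ)⁻¹ • ∑ k : G, groupMultiplier α k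
  rw [mul_smul_comm, Finset.mul_sum]
  simp only [← groupMultiplier_mul]
  congr 1
  exact Fintype.sum_equiv (Equiv.mulLeft g) _ _ fun _ => rfl

theorem averagingProjection_mul_groupMultiplier (g : G) :
    averagingProjection α * groupMultiplier α g = averagingProjection α := by
  let := Fintype.ofFinite G
  change ((Nat.card G : ℂ)⁻¹ • ∑ k : G, groupMultiplier α k) * groupMultiplier α g =
    (Nat.card G : ℂ)⁻¹ • ∑ k : G, groupMultiplier α k
  rw [smul_mul_assoc, Finset.sum_mul]
  simp only [← groupMultiplier_mul]
  congr 1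
  exact Fintype.sum_equiv (Equiv.mulRight g) _ _ fun _ => rfl

variable {α}

theorem inv_card_smul_sum_const [Fintype G] {M : Type*} [AddCommGroup M] [Module ℂ M] (m : M) :
    (Nat.card G : ℂ)⁻¹ • ∑ _g : G, m = m := by
  rw [Finset.sum_const, Finset.card_univ, ← Nat.card_eq_fintype_card, ← Nat.cast_smul_eq_nsmul ℂ,
    smul_smul, inv_mul_cancel₀ (Nat.cast_ne_zero.mpr Nat.card_pos.ne'), one_smul]

/-- Since `u_g p = p`, being fixed by `p` on the left is the same as being fixed by every `u_g`,
which ties all coefficients to the one at `1`. -/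
theorem averagingProjection_fst_eq_self_iff {f : CrossedProduct α} :
    (averagingProjection α).fst f = f ↔ ∀ h, f.coeff h = α h (f.coeff 1) := by
  let := Fintype.ofFinite G
  constructor
  · intro hf h
    have h₁ : (groupMultiplier α h).fst f = f := by
      conv_rhs => rw [← hf, ← groupMultiplier_mul_averagingProjection α h]
      change _ = (groupMultiplier α h).fst ((averagingProjection α).fst f)
      rw [hf]
    conv_lhs => rw [← h₁, coeff_groupMultiplier_fst, inv_mul_cancel]
  · intro hf
    have h₁ (g : G) : (groupMultiplier α g).fst f = f := by
      ext k
      rw [coeff_groupMultiplier_fst, hf, hf k, ← act_mul_apply, mul_inv_cancel_left]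
    simp only [averagingProjection_fst, h₁, inv_card_smul_sum_const]

/-- The same argument with `p u_g = p`; right translation does not involve the action, so the
coefficients are constant. -/
theorem averagingProjection_snd_eq_self_iff {f : CrossedProduct α} :
    (averagingProjection α).snd f = f ↔ ∀ h, f.coeff h = f.coeff 1 := by
  let := Fintype.ofFinite G
  constructor
  · intro hf h
    have h₁ : (groupMultiplier α h).snd f = f := by
      conv_rhs => rw [← hf, ← averagingProjection_mul_groupMultiplier α h]
      change _ = (groupMultiplier α h).snd ((averagingProjection α).snd f)
      rw [hf]
    conv_lhs => rw [← h₁, coeff_groupMultiplier_snd, mul_inv_cancel]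
  · intro hf
    have h₁ (g : G) : (groupMultiplier α g).snd f = f := by
      ext k
      rw [coeff_groupMultiplier_snd, hf, hf k]
    simp only [averagingProjection_snd, h₁, inv_card_smul_sum_const]

theorem mem_corner_averagingProjection_iff {f : CrossedProduct α} :
    f ∈ corner (averagingProjection α) (isStarProjection_averagingProjection α) ↔
      ∀ h, f.coeff h = f.coeff 1 ∧ f.coeff h = α h (f.coeff 1) := by
  rw [mem_corner_iff, averagingProjection_fst_eq_self_iff, averagingProjection_snd_eq_self_iff,
    and_comm, forall_and]

end Averaging

/-! ### The corner as families of spectral components -/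

section DualCorner

variable {H A : Type*} [CommGroup H] [Finite H] [NonUnitalCStarAlgebra A]
  {β : H →* (A ≃⋆ₐ[ℂ] A)}

theorem coeff_dualAction (x : H →* Circle) (f : CrossedProduct β) (h : H) :
    (dualAction β x f).coeff h = star (x h : ℂ) • f.coeff h := rfl

/-- The corner cut out by the averaging projection of `H` in an iterated crossed product, for an
action that factors through the dual action. -/
theorem mem_corner_multiplierInclusion_iff {K : Type*} [Group K] [Finite K]
    {γ : K →* (CrossedProduct β ≃⋆ₐ[ℂ] CrossedProduct β)} {π : K →* (H →* Circle)}
    (hγ : ∀ k, γ k = dualAction β (π k)) {F : CrossedProduct γ}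
    {hp : IsStarProjection (multiplierInclusion γ (averagingProjection β))} :
    F ∈ corner (multiplierInclusion γ (averagingProjection β)) hp ↔
      ∀ x h, (F.coeff x).coeff h = star (π x h : ℂ) • (F.coeff x).coeff 1 ∧
        (F.coeff x).coeff h = β h ((F.coeff x).coeff 1) := by
  rw [mem_corner_iff, and_comm]
  simp only [forall_and]
  refine and_congr ?_ ?_
  · rw [CrossedProduct.ext_iff, funext_iff]
    refine forall_congr' fun x => ?_
    -- Right multiplication by `p` reaches the coefficient of `v_x` conjugated by `γ_x`; untwisting
    -- reduces the condition to the untwisted one for `γ_x⁻¹(F_x)`.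
    have h₁ : γ x ((averagingProjection β).snd (γ x⁻¹ (F.coeff x))) = F.coeff x ↔
        (averagingProjection β).snd (γ x⁻¹ (F.coeff x)) = γ x⁻¹ (F.coeff x) :=
      ⟨fun e => by conv_rhs => rw [← e, act_inv_act], fun e => by rw [e, act_act_inv]⟩
    refine h₁.trans (averagingProjection_snd_eq_self_iff.trans (forall_congr' fun h => ?_))
    have h₂ (g : H) : (γ x⁻¹ (F.coeff x)).coeff g = (π x g : ℂ) • (F.coeff x).coeff g := by
      rw [hγ, coeff_dualAction, map_inv, MonoidHom.inv_apply, Circle.coe_inv_eq_conj]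
      exact congrArg (· • _) (star_star _)
    rw [h₂, h₂, map_one, Circle.coe_one, one_smul]
    constructor
    · intro e
      rw [← e, smul_smul, star_circle_mul_self, one_smul]
    · intro e
      rw [e, smul_smul, mul_comm, star_circle_mul_self, one_smul]
  · rw [CrossedProduct.ext_iff, funext_iff]
    exact forall_congr' fun x => averagingProjection_fst_eq_self_iff

theorem mem_corner_dualAction_iff {F : CrossedProduct (dualAction β)}
    {hp : IsStarProjection (multiplierInclusion (dualAction β) (averagingProjection β))} :
    F ∈ corner (multiplierInclusion (dualAction β) (averagingProjection β)) hp ↔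
      ∀ x h, (F.coeff x).coeff h = star (x h : ℂ) • (F.coeff x).coeff 1 ∧
        (F.coeff x).coeff h = β h ((F.coeff x).coeff 1) :=
  mem_corner_multiplierInclusion_iff (π := MonoidHom.id _) fun _ => rfl

theorem coeff_finset_sum {ι : Type*} (s : Finset ι) (f : ι → CrossedProduct β) (h : H) :
    (∑ i ∈ s, f i).coeff h = ∑ i ∈ s, (f i).coeff h :=
  map_sum (⟨⟨fun f => f.coeff h, rfl⟩, fun _ _ => rfl⟩ : CrossedProduct β →+ A) f s

variable (β) in
/-- The corner of the double crossed product cut out by the averaging projection. -/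
noncomputable abbrev dualCorner : NonUnitalStarSubalgebra ℂ (CrossedProduct (dualAction β)) :=
  corner (multiplierInclusion (dualAction β) (averagingProjection β))
    ((isStarProjection_averagingProjection β).map (multiplierInclusion (dualAction β)))

theorem dualCorner_coeff {F : CrossedProduct (dualAction β)} (hF : F ∈ dualCorner β)
    (x : H →* Circle) (h : H) :
    (F.coeff x).coeff h = star (x h : ℂ) • (F.coeff x).coeff 1 :=
  (mem_corner_dualAction_iff.1 hF x h).1

theorem dualCorner_act {F : CrossedProduct (dualAction β)} (hF : F ∈ dualCorner β)
    (x : H →* Circle) (h : H) :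
    β h ((F.coeff x).coeff 1) = star (x h : ℂ) • (F.coeff x).coeff 1 := by
  rw [← (mem_corner_dualAction_iff.1 hF x h).2, dualCorner_coeff hF]

theorem dualCorner_ext {F G : CrossedProduct (dualAction β)} (hF : F ∈ dualCorner β)
    (hG : G ∈ dualCorner β) (h : ∀ x, (F.coeff x).coeff 1 = (G.coeff x).coeff 1) : F = G := by
  ext x k
  rw [dualCorner_coeff hF, dualCorner_coeff hG, h]

/-- In the inner convolution over `H`, the twist by the dual action cancels the phases of `F`, and
`β_k` cancels against the form of the coefficients of `G`. All `|H|` terms are therefore equal,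
which gives the factor. -/
theorem coeff_one_mul_dualCorner [Fintype (H →* Circle)] {F G : CrossedProduct (dualAction β)}
    (hF : F ∈ dualCorner β) (hG : G ∈ dualCorner β) (z : H →* Circle) :
    ((F * G).coeff z).coeff 1 =
      (Nat.card H : ℂ) • ∑ y, (F.coeff y).coeff 1 * (G.coeff (y⁻¹ * z)).coeff 1 := by
  let := Fintype.ofFinite H
  rw [coeff_mul, coeff_finset_sum, Finset.smul_sum]
  refine Finset.sum_congr rfl fun y _ => ?_
  rw [coeff_mul]
  have h₁ (k : H) : (F.coeff y).coeff k *
      β k ((dualAction β y (G.coeff (y⁻¹ * z))).coeff (k⁻¹ * 1)) =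
        (F.coeff y).coeff 1 * (G.coeff (y⁻¹ * z)).coeff 1 := by
    rw [coeff_dualAction, mul_one, (mem_corner_dualAction_iff.1 hG _ k⁻¹).2, map_smul,
      act_act_inv, dualCorner_coeff hF, smul_mul_smul_comm, map_inv, Circle.coe_inv_eq_conj,
      ← star_mul', ← starRingEnd_apply, mul_comm]
    change starRingEnd ℂ (star (y k : ℂ) * (y k : ℂ)) • _ = _
    rw [star_circle_mul_self, map_one, one_smul]
  rw [Finset.sum_congr rfl fun k _ => h₁ k, Finset.sum_const, Finset.card_univ,
    ← Nat.card_eq_fintype_card, Nat.cast_smul_eq_nsmul]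

/-! ### Evaluation onto `A` and Fourier inversion -/

variable (β) in
/-- The evaluation `∑ a_x v_x p ↦ ∑ a_x` of the corner of the double crossed product, where the
coefficients `a_x` are homogeneous of degree `x`. -/
noncomputable def dualCornerEval : dualCorner β →⋆ₙₐ[ℂ] A where
  -- The factor `|H|` arises from `∑_h conj x(h) u_h v_x = |H| v_x p`; it also makes the map
  -- multiplicative.
  toFun F :=
    letI := Fintype.ofFinite (H →* Circle)
    (Nat.card H : ℂ) • ∑ x, (F.1.coeff x).coeff 1
  map_zero' := by simp [coeff_zero]
  map_add' F G := by simp [coeff_add, Finset.sum_add_distrib]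
  map_smul' c F := by
    simp only [MonoidHom.id_apply, NonUnitalStarSubalgebra.coe_smul, coeff_smul, ← Finset.smul_sum]
    rw [smul_comm]
  map_mul' F G := by
    let := Fintype.ofFinite (H →* Circle)
    rw [smul_mul_smul_comm, ← smul_smul, Finset.sum_mul_sum]
    congr 1
    change ∑ x, ((F.1 * G.1).coeff x).coeff 1 = _
    simp only [coeff_one_mul_dualCorner F.2 G.2]
    rw [← Finset.smul_sum, Finset.sum_comm]
    congr 1
    refine Finset.sum_congr rfl fun y _ => ?_
    exact Fintype.sum_equiv (Equiv.mulLeft y⁻¹) _ _ fun _ => rfl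
  map_star' F := by
    let := Fintype.ofFinite (H →* Circle)
    rw [star_smul, star_sum, star_natCast]
    congr 1
    -- The involution exchanges the degrees `x` and `x⁻¹`.
    refine Fintype.sum_equiv (Equiv.inv _) _ _ fun x => ?_
    change (dualAction β x (star (F.1.coeff x⁻¹))).coeff 1 = _
    rw [coeff_dualAction, coeff_star, map_one, inv_one, act_one_apply]
    simp

theorem dualCornerEval_apply [inst : Fintype (H →* Circle)] (F : dualCorner β) :
    dualCornerEval β F = (Nat.card H : ℂ) • ∑ x, (F.1.coeff x).coeff 1 := by
  rw [Subsingleton.elim inst (Fintype.ofFinite _)]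
  rfl

/-- The homogeneous components of an element of `A` recover the coefficients in the corner. -/
theorem coeff_one_eq_sum_act_dualCornerEval [Fintype H] (F : dualCorner β) (x : H →* Circle) :
    ((Nat.card H : ℂ) ^ 2) • (F.1.coeff x).coeff 1 =
      ∑ h, (x h : ℂ) • β h (dualCornerEval β F) := by
  classical
  let := Fintype.ofFinite (H →* Circle)
  have h₁ (y : H →* Circle) (h : H) : (x h : ℂ) • (Nat.card H : ℂ) • star (y h : ℂ) •
      (F.1.coeff y).coeff 1 =
        (Nat.card H : ℂ) • ((x h : ℂ) * star (y h : ℂ)) • (F.1.coeff y).coeff 1 := by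
    rw [smul_comm, smul_smul (x h : ℂ)]
  simp only [dualCornerEval_apply, map_smul, map_sum, dualCorner_act F.2, Finset.smul_sum, h₁]
  -- Orthogonality kills every degree other than `x`. One factor `|H|` comes from the evaluation,
  -- the other from `∑_h |x(h)|²`.
  rw [Finset.sum_comm, Finset.sum_eq_single x]
  · simp only [circle_mul_star_self, one_smul]
    rw [Finset.sum_const, Finset.card_univ, ← Nat.card_eq_fintype_card, sq, ← smul_smul,
      Nat.cast_smul_eq_nsmul]
  · intro y _ hy
    rw [← Finset.smul_sum, ← Finset.sum_smul, sum_circle_mul_star hy.symm, zero_smul, smul_zero]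
  · simp

theorem dualCornerEval_injective : Function.Injective (dualCornerEval β) := by
  let := Fintype.ofFinite H
  intro F G h
  refine Subtype.ext (dualCorner_ext F.2 G.2 fun x => ?_)
  have hn : ((Nat.card H : ℂ) ^ 2) ≠ 0 := pow_ne_zero 2 (Nat.cast_ne_zero.2 Nat.card_pos.ne')
  refine smul_right_injective A hn ?_
  change _ • _ = _ • _
  rw [coeff_one_eq_sum_act_dualCornerEval, coeff_one_eq_sum_act_dualCornerEval, h]

theorem dualCornerEval_surjective : Function.Surjective (dualCornerEval β) := by
  classical
  let := Fintype.ofFinite H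
  let := Fintype.ofFinite (H →* Circle)
  intro a
  have hn : ((Nat.card H : ℂ)) ≠ 0 := Nat.cast_ne_zero.2 Nat.card_pos.ne'
  -- The unnormalised spectral projection of `a` to degree `x`.
  let e (x : H →* Circle) : A := ∑ h, (x h : ℂ) • β h a
  have he (x : H →* Circle) (g : H) : β g (e x) = star (x g : ℂ) • e x := by
    simp only [e, map_sum, map_smul, Finset.smul_sum, smul_smul, ← act_mul_apply]
    refine Fintype.sum_equiv (Equiv.mulLeft g) _ _ fun h => ?_
    have hx : (x (g * h) : ℂ) = x g * x h := by rw [map_mul, Circle.coe_mul]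
    change _ = (star (x g : ℂ) * (x (g * h) : ℂ)) • β (g * h) a
    rw [hx, ← mul_assoc, star_circle_mul_self, one_mul]
  -- Summing over `x` leaves only `h = 1`, with weight `|Ĥ| = |H|`.
  have hsum : ∑ x, e x = (Nat.card H : ℂ) • a := by
    simp only [e]
    rw [Finset.sum_comm, Finset.sum_eq_single 1]
    · simp [← Nat.card_eq_fintype_card, card_circle_dual,
        Nat.cast_smul_eq_nsmul]
    · intro h _ hh
      rw [← Finset.sum_smul, sum_circle_dual hh, zero_smul]
    · simp
  -- The constant `|H|⁻²` offsets the `|H|` of the evaluation and the `|H|` of `hsum`.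
  let F : CrossedProduct (dualAction β) :=
    ⟨fun x => ⟨fun h => ((Nat.card H : ℂ) ^ 2)⁻¹ • star (x h : ℂ) • e x⟩⟩
  have hF₁ (x : H →* Circle) : (F.coeff x).coeff 1 = ((Nat.card H : ℂ) ^ 2)⁻¹ • e x := by
    change _ • star (x 1 : ℂ) • e x = _
    rw [map_one, Circle.coe_one, star_one, one_smul]
  have hF : F ∈ dualCorner β := by
    refine mem_corner_dualAction_iff.2 fun x h => ⟨?_, ?_⟩
    · rw [hF₁, smul_comm]
    · rw [hF₁, map_smul, he]
  refine ⟨⟨F, hF⟩, ?_⟩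
  rw [dualCornerEval_apply]
  simp only [hF₁]
  rw [← Finset.smul_sum, hsum, smul_smul, smul_smul, mul_assoc, mul_comm _ (Nat.card H : ℂ),
    ← mul_assoc, ← sq, mul_inv_cancel₀ (pow_ne_zero 2 hn), one_smul]

variable (β) in
/-- The evaluation map as an isomorphism of the corner of the double crossed product onto `A`. -/
noncomputable def dualCornerEquiv : dualCorner β ≃⋆ₐ[ℂ] A :=
  StarAlgEquiv.ofBijective (dualCornerEval β) ⟨dualCornerEval_injective, dualCornerEval_surjective⟩

/-! ### Fixed points as support conditions -/

/-- As `β_l` multiplies the component of degree `x` by `conj x(l)`, an invariant element can have no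
component where this scalar differs from `1`. -/
theorem dualCornerEval_fixed_iff (F : dualCorner β) (l : H) :
    β l (dualCornerEval β F) = dualCornerEval β F ↔ ∀ x, x l ≠ 1 → F.1.coeff x = 0 := by
  let := Fintype.ofFinite H
  let := Fintype.ofFinite (H →* Circle)
  constructor
  · intro h x hx
    have hn : ((Nat.card H : ℂ) ^ 2) ≠ 0 := pow_ne_zero 2 (Nat.cast_ne_zero.2 Nat.card_pos.ne')
    -- Since `H` is commutative, the spectral projections commute with `β_l`, so invariance passes
    -- to each component.
    have h₁ : β l ((F.1.coeff x).coeff 1) = (F.1.coeff x).coeff 1 := by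
      refine smul_right_injective A hn ?_
      change _ • _ = _ • _
      rw [← map_smul, coeff_one_eq_sum_act_dualCornerEval]
      simp only [map_sum, map_smul, ← act_mul_apply]
      refine Finset.sum_congr rfl fun k _ => ?_
      rw [mul_comm, act_mul_apply, h]
    have h₂ : (1 - star (x l : ℂ)) • (F.1.coeff x).coeff 1 = 0 := by
      rw [sub_smul, one_smul, ← dualCorner_act F.2, h₁, sub_self]
    have h₃ : (1 - star (x l : ℂ)) ≠ 0 := fun h₄ => hx <| Circle.ext <| by
      rw [Circle.coe_one, ← star_star (x l : ℂ), ← sub_eq_zero.1 h₄, star_one]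
    ext k
    rw [dualCorner_coeff F.2, (smul_eq_zero.1 h₂).resolve_left h₃, smul_zero]
    rfl
  · intro h
    rw [dualCornerEval_apply, map_smul, map_sum]
    congr 1
    refine Finset.sum_congr rfl fun x _ => ?_
    by_cases hx : x l = 1
    · rw [dualCorner_act F.2, hx, Circle.coe_one, star_one, one_smul]
    · rw [h x hx, coeff_zero, map_zero]

/-- Expresses images under `ψ` through the evaluation, so that no formula for `ψ` is needed
afterwards. -/
theorem image_dualCornerEquiv_symm (S : Set A) :
    (fun a => ((dualCornerEquiv β).symm a : CrossedProduct (dualAction β))) '' S =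
      {F | ∃ hF : F ∈ dualCorner β, dualCornerEval β ⟨F, hF⟩ ∈ S} := by
  ext F
  constructor
  · rintro ⟨a, ha, rfl⟩
    refine ⟨Subtype.coe_prop _, ?_⟩
    change dualCornerEquiv β ((dualCornerEquiv β).symm a) ∈ S
    rwa [StarAlgEquiv.apply_symm_apply]
  · rintro ⟨hF, h⟩
    refine ⟨_, h, ?_⟩
    change (((dualCornerEquiv β).symm (dualCornerEquiv β ⟨F, hF⟩) : dualCorner β) :
      CrossedProduct (dualAction β)) = F
    rw [StarAlgEquiv.symm_apply_apply]

/-- Both sides are the elements of the big corner supported on `L^⊥`: a character outside `L^⊥` is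
nontrivial at some `l ∈ L`, and conversely. The corner conditions at each `x ∈ L^⊥` are the same in
both crossed products. -/
theorem image_fixedPointAlgebra_restrict (L : Subgroup H)
    {hp : IsStarProjection (multiplierInclusion ((dualAction β).comp (annihilator L).subtype)
      (averagingProjection β))} :
    (fun a => ((dualCornerEquiv β).symm a : CrossedProduct (dualAction β))) ''
        (fixedPointAlgebra (β.comp L.subtype) : Set A) =
      subgroupInclusion (dualAction β) (annihilator L) ''
        (corner (multiplierInclusion ((dualAction β).comp (annihilator L).subtype)
          (averagingProjection β)) hp :
          Set (CrossedProduct ((dualAction β).comp (annihilator L).subtype))) := by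
  have hmem {f : CrossedProduct ((dualAction β).comp (annihilator L).subtype)} :=
    mem_corner_multiplierInclusion_iff (π := (annihilator L).subtype) (fun _ => rfl) (F := f)
      (hp := hp)
  rw [image_dualCornerEquiv_symm]
  ext F
  constructor
  · rintro ⟨hF, h⟩
    -- The preimage is the restriction of the coefficients to `L^⊥`; nothing is lost because `F`
    -- vanishes elsewhere.
    refine ⟨⟨fun x => F.coeff x⟩, hmem.2 fun x h => mem_corner_dualAction_iff.1 hF x h, ?_⟩
    ext1
    funext x
    by_cases hx : x ∈ annihilator L
    · exact dif_pos hx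
    · refine (dif_neg hx).trans ?_
      obtain ⟨l, hl, hxl⟩ : ∃ l ∈ L, x l ≠ 1 := by
        by_contra! h'
        exact hx h'
      exact ((dualCornerEval_fixed_iff ⟨F, hF⟩ l).1 (h ⟨l, hl⟩) x hxl).symm
  · rintro ⟨f, hf, rfl⟩
    have hpos {x : H →* Circle} (hx : x ∈ annihilator L) :
        (subgroupInclusion (dualAction β) (annihilator L) f).coeff x = f.coeff ⟨x, hx⟩ :=
      dif_pos hx
    have hneg {x : H →* Circle} (hx : x ∉ annihilator L) :
        (subgroupInclusion (dualAction β) (annihilator L) f).coeff x = 0 := dif_neg hx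
    have hF : subgroupInclusion (dualAction β) (annihilator L) f ∈ dualCorner β := by
      refine mem_corner_dualAction_iff.2 fun x h => ?_
      by_cases hx : x ∈ annihilator L
      · rw [hpos hx]
        exact hmem.1 hf ⟨x, hx⟩ h
      · simp [hneg hx, coeff_zero]
    refine ⟨hF, fun l => (dualCornerEval_fixed_iff ⟨_, hF⟩ l).2 fun x hx => ?_⟩
    exact hneg fun h => hx (h l l.2)

/-- Invariance under all of `H` forces support at the trivial character. There the phases disappear,
and the conditions on the coefficient become those of the corner of `A ⋊ H`. -/
theorem image_fixedPointAlgebra :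
    (fun a => ((dualCornerEquiv β).symm a : CrossedProduct (dualAction β))) ''
        (fixedPointAlgebra β : Set A) =
      inclusion (dualAction β) ''
        (corner (averagingProjection β) (isStarProjection_averagingProjection β) :
          Set (CrossedProduct β)) := by
  rw [image_dualCornerEquiv_symm]
  have hinc (f : CrossedProduct β) : (inclusion (dualAction β) f).coeff 1 = f := if_pos rfl
  have hne (f : CrossedProduct β) {x : H →* Circle} (hx : x ≠ 1) :
      (inclusion (dualAction β) f).coeff x = 0 := if_neg hx
  ext F
  constructor
  · rintro ⟨hF, h⟩
    refine ⟨F.coeff 1, mem_corner_averagingProjection_iff.2 fun k => ?_, ?_⟩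
    · simpa using mem_corner_dualAction_iff.1 hF 1 k
    · ext1
      funext x
      by_cases hx : x = 1
      · rw [hx, hinc]
      · rw [hne _ hx]
        obtain ⟨l, hl⟩ := DFunLike.ne_iff.1 hx
        exact ((dualCornerEval_fixed_iff ⟨F, hF⟩ l).1 (h l) x hl).symm
  · rintro ⟨f, hf, rfl⟩
    have hF : inclusion (dualAction β) f ∈ dualCorner β := by
      refine mem_corner_dualAction_iff.2 fun x h => ?_
      by_cases hx : x = 1
      · rw [hx, hinc]
        simpa using mem_corner_averagingProjection_iff.1 hf h
      · simp [hne _ hx, coeff_zero]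
    refine ⟨hF, fun l => (dualCornerEval_fixed_iff ⟨_, hF⟩ l).2 fun x hx => ?_⟩
    refine hne _ fun h => hx ?_
    rw [h, MonoidHom.one_apply]

end DualCorner

end CrossedProduct

theorem proposition3p1 {A H : Type*} [NonUnitalCStarAlgebra A] [CommGroup H] [Finite H]
    (β : H →* (A ≃⋆ₐ[ℂ] A)) :
    ∃ ψ : A ≃⋆ₐ[ℂ]
        corner (CrossedProduct.multiplierInclusion (CrossedProduct.dualAction β) (CrossedProduct.averagingProjection β))
          ((CrossedProduct.isStarProjection_averagingProjection β).map (CrossedProduct.multiplierInclusion (CrossedProduct.dualAction β))),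
      (fun a => (ψ a : CrossedProduct (CrossedProduct.dualAction β))) '' (fixedPointAlgebra β : Set A) =
        CrossedProduct.inclusion (CrossedProduct.dualAction β) ''
          (corner (CrossedProduct.averagingProjection β) (CrossedProduct.isStarProjection_averagingProjection β) :
            Set (CrossedProduct β)) ∧
      ∀ L : Subgroup H,
        (fun a => (ψ a : CrossedProduct (CrossedProduct.dualAction β))) ''
            (fixedPointAlgebra (β.comp L.subtype) : Set A) =
          CrossedProduct.subgroupInclusion (CrossedProduct.dualAction β) (CrossedProduct.annihilator L) ''
            (corner
              (CrossedProduct.multiplierInclusion ((CrossedProduct.dualAction β).comp (CrossedProduct.annihilator L).subtype)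
                (CrossedProduct.averagingProjection β))
              ((CrossedProduct.isStarProjection_averagingProjection β).map
                (CrossedProduct.multiplierInclusion ((CrossedProduct.dualAction β).comp (CrossedProduct.annihilator L).subtype))) :
              Set (CrossedProduct ((CrossedProduct.dualAction β).comp (CrossedProduct.annihilator L).subtype))) := by
  exact ⟨(CrossedProduct.dualCornerEquiv β).symm, CrossedProduct.image_fixedPointAlgebra,
    fun L => CrossedProduct.image_fixedPointAlgebra_restrict L⟩
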